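/- Theorem 3.5 (Goursat's second theorem). Let $R\in\mathbb{C}[t]$ be a polynomial of degree $3$ or $4$ with simple roots. Its roots in $\mathbb{P}^1(\mathbb{C})=\mathbb{C}\cup\{\infty\}$ are its four complex roots if $\deg R=4$, and its three complex roots together with $\infty$ if $\deg R=3$. Let $S_1,S_2,S_3\in\operatorname{PGL}_2(\mathbb{C})$ be the three Möbius involutions that permute these four points in pairs, that is, three distinct elements of order two, each of which maps the set of these four points to itself and fixes none of them. Let $F\in\mathbb{C}(t)$. If $$F+F\circ S_1+F\circ S_2+F\circ S_3=0$$ identically, then the integral $\int F\,dt/\sqrt{R}$ is pseudo-elliptic, i.e. elementary: in the differential field $K=\mathbb{C}(t)(y)$, $y^2=R$, with the derivation extending $d/dt$, the element $f=F/y$ has an elementary integral, which means that there are a differential field extension $L\supseteq K$ and an element $g\in L$ with $g'=f$, and a tower of fields $K=K_0\subseteq K_1\subseteq\dots\subseteq K_n=L$ such that for each $i<n$ one has $K_{i+1}=K_i(\theta_i)$, where $\theta_i$ is algebraic over $K_i$, or $\theta_i\neq 0$ is an exponential ($\theta_i'/\theta_i=\eta'$ for some $\eta\in K_i$), or $\theta_i$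 is a logarithm ($\theta_i'=\eta'/\eta$ for some $\eta\in K_i$, $\eta\ne 0$). -/

import Mathlib

namespace Goursat

open Polynomial
open scoped Differential IntermediateField

noncomputable section

/-! ### The differential field `ℂ(t)` -/

/-- `d/dt` on `ℂ(t)`, by the quotient rule applied to the reduced fraction. -/
def ddt (f : RatFunc ℂ) : RatFunc ℂ :=
  (algebraMap ℂ[X] (RatFunc ℂ) (derivative f.num) * algebraMap ℂ[X] (RatFunc ℂ) f.denom -
      algebraMap ℂ[X] (RatFunc ℂ) f.num * algebraMap ℂ[X] (RatFunc ℂ) (derivative f.denom)) /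
    algebraMap ℂ[X] (RatFunc ℂ) f.denom ^ 2

/-- The quotient rule holds for every representation of a rational function as a fraction. -/
theorem ddt_div (p q : ℂ[X]) (hq : q ≠ 0) :
    ddt (algebraMap ℂ[X] (RatFunc ℂ) p / algebraMap ℂ[X] (RatFunc ℂ) q) =
      (algebraMap ℂ[X] (RatFunc ℂ) (derivative p) * algebraMap ℂ[X] (RatFunc ℂ) q -
          algebraMap ℂ[X] (RatFunc ℂ) p * algebraMap ℂ[X] (RatFunc ℂ) (derivative q)) /
        algebraMap ℂ[X] (RatFunc ℂ) q ^ 2 := by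
  set f : RatFunc ℂ := algebraMap ℂ[X] (RatFunc ℂ) p / algebraMap ℂ[X] (RatFunc ℂ) q with hf
  have hd : f.denom ≠ 0 := f.denom_ne_zero
  have hq' : algebraMap ℂ[X] (RatFunc ℂ) q ≠ 0 := RatFunc.algebraMap_ne_zero hq
  have hd' : algebraMap ℂ[X] (RatFunc ℂ) f.denom ≠ 0 := RatFunc.algebraMap_ne_zero hd
  have h : f.num * q = p * f.denom := by
    apply RatFunc.algebraMap_injective ℂ
    have h1 := f.num_div_denom
    rw [hf, div_eq_div_iff (by rw [← hf]; exact hd') hq', ← hf] at h1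
    simpa using h1
  have h' := congrArg derivative h
  simp only [derivative_mul] at h'
  have e := congrArg (algebraMap ℂ[X] (RatFunc ℂ)) h
  have e' := congrArg (algebraMap ℂ[X] (RatFunc ℂ)) h'
  simp only [map_mul, map_add] at e e'
  unfold ddt
  rw [div_eq_div_iff (pow_ne_zero 2 hd') (pow_ne_zero 2 hq')]
  linear_combination (algebraMap ℂ[X] (RatFunc ℂ) q * algebraMap ℂ[X] (RatFunc ℂ) f.denom) * e' -
    (algebraMap ℂ[X] (RatFunc ℂ) (derivative q) * algebraMap ℂ[X] (RatFunc ℂ) f.denom +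
      algebraMap ℂ[X] (RatFunc ℂ) q * algebraMap ℂ[X] (RatFunc ℂ) (derivative f.denom)) * e

theorem exists_frac (f : RatFunc ℂ) : ∃ p q : ℂ[X], q ≠ 0 ∧
    f = algebraMap ℂ[X] (RatFunc ℂ) p / algebraMap ℂ[X] (RatFunc ℂ) q :=
  ⟨f.num, f.denom, f.denom_ne_zero, f.num_div_denom.symm⟩

theorem ddt_add (f g : RatFunc ℂ) : ddt (f + g) = ddt f + ddt g := by
  obtain ⟨p, q, hq, rfl⟩ := exists_frac f
  obtain ⟨r, s, hs, rfl⟩ := exists_frac g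
  have hq' := RatFunc.algebraMap_ne_zero hq
  have hs' := RatFunc.algebraMap_ne_zero hs
  have := ddt_div (p * s + q * r) (q * s) (mul_ne_zero hq hs)
  rw [ddt_div p q hq, ddt_div r s hs, div_add_div _ _ hq' hs', ← map_mul, ← map_mul, ← map_add,
    ← map_mul, this]
  simp only [derivative_mul, map_add, map_mul]
  field_simp
  ring

theorem ddt_mul (f g : RatFunc ℂ) : ddt (f * g) = f * ddt g + g * ddt f := by
  obtain ⟨p, q, hq, rfl⟩ := exists_frac f
  obtain ⟨r, s, hs, rfl⟩ := exists_frac g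
  have hq' := RatFunc.algebraMap_ne_zero hq
  have hs' := RatFunc.algebraMap_ne_zero hs
  have := ddt_div (p * r) (q * s) (mul_ne_zero hq hs)
  rw [ddt_div p q hq, ddt_div r s hs, div_mul_div_comm, ← map_mul, ← map_mul, this]
  simp only [derivative_mul, map_add, map_mul]
  field_simp
  ring

/-- An additive map satisfying the Leibniz rule makes a field a differential field. -/
@[reducible]
def differentialOfLeibniz {K : Type} [Field K] (d : K → K) (hadd : ∀ f g, d (f + g) = d f + d g)
    (hmul : ∀ f g, d (f * g) = f * d g + g * d f) : Differential K where
  deriv := Derivation.mk' (AddMonoidHom.mk' d hadd).toIntLinearMap hmul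

/-- `ℂ(t)` as a differential field, with derivation `d/dt`. -/
instance : Differential (RatFunc ℂ) :=
  differentialOfLeibniz ddt ddt_add ddt_mul

/-! ### Elementary extensions and elementary integrals -/

/-- `L` is an elementary extension of `K`: there is a tower `K = E 0 ⊆ ⋯ ⊆ E n = L` in which
`E (i + 1) = (E i)(θ)` where `θ` is algebraic over `E i`, or an exponential of an element of `E i`,
or a logarithm of a non-zero element of `E i`.  (Every `E i` is then stable under the derivation of
`L`.) -/
def IsElementaryExtension (K L : Type) [Field K] [Field L] [Differential L] [Algebra K L] : Prop :=
  ∃ (n : ℕ) (E : ℕ → IntermediateField K L), E 0 = ⊥ ∧ E n = ⊤ ∧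
    ∀ i < n, ∃ θ : L, E (i + 1) = E i ⊔ K⟮θ⟯ ∧
      (IsAlgebraic (E i) θ ∨
        (θ ≠ 0 ∧ ∃ η ∈ E i, θ′ / θ = η′) ∨
        (∃ η ∈ E i, η ≠ 0 ∧ θ′ = η′ / η))

/-- `f ∈ K` has an elementary integral: it has an antiderivative in some elementary extension
of the differential field `K`. -/
def HasElementaryIntegral {K : Type} [Field K] [Differential K] (f : K) : Prop :=
  ∃ (L : Type) (_ : Field L) (_ : Differential L) (_ : Algebra K L) (_ : DifferentialAlgebra K L),
    IsElementaryExtension K L ∧ ∃ g : L, g′ = algebraMap K L f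

/-- `∫ F dt / √R` is pseudo-elliptic: in the differential field `K = ℂ(t)(y)`, `y² = R`, the element
`F / y` has an elementary integral.  The field `K` is unique up to isomorphism, so it is specified
by its defining property; it exists by `exists_sqrt_field`. -/
def IsPseudoElliptic (R : ℂ[X]) (F : RatFunc ℂ) : Prop :=
  ∀ (K : Type) [Field K] [Differential K] [Algebra (RatFunc ℂ) K]
    [DifferentialAlgebra (RatFunc ℂ) K] (y : K),
    y ^ 2 = algebraMap (RatFunc ℂ) K (algebraMap ℂ[X] (RatFunc ℂ) R) →
    (RatFunc ℂ)⟮y⟯ = ⊤ →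
    HasElementaryIntegral (algebraMap (RatFunc ℂ) K F / y)

theorem exists_sqrt_field (R : ℂ[X]) :
    ∃ (K : Type) (_ : Field K) (_ : Differential K) (_ : Algebra (RatFunc ℂ) K)
      (_ : DifferentialAlgebra (RatFunc ℂ) K) (y : K),
      y ^ 2 = algebraMap (RatFunc ℂ) K (algebraMap ℂ[X] (RatFunc ℂ) R) ∧
      (RatFunc ℂ)⟮y⟯ = ⊤ := by
  obtain ⟨z, hz⟩ := IsAlgClosed.exists_pow_nat_eq
    (algebraMap (RatFunc ℂ) (AlgebraicClosure (RatFunc ℂ)) (algebraMap ℂ[X] (RatFunc ℂ) R))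
    (n := 2) (by norm_num)
  have : CharZero (RatFunc ℂ) := algebraRat.charZero _
  have : FiniteDimensional (RatFunc ℂ) (RatFunc ℂ)⟮z⟯ :=
    IntermediateField.adjoin.finiteDimensional (Algebra.IsIntegral.isIntegral z)
  let := Differential.differentialFiniteDimensional (RatFunc ℂ) (RatFunc ℂ)⟮z⟯
  refine ⟨(RatFunc ℂ)⟮z⟯, inferInstance, inferInstance, inferInstance,
    Differential.differentialAlgebraFiniteDimensional,
    IntermediateField.AdjoinSimple.gen (RatFunc ℂ) z, ?_, ?_⟩
  · apply Subtype.ext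
    simpa using hz
  · apply IntermediateField.lift_injective
    rw [IntermediateField.lift_adjoin_simple, IntermediateField.lift_top,
      IntermediateField.AdjoinSimple.coe_gen]

/-! ### Möbius transformations

A Möbius transformation is an element of `PGL₂(ℂ)`; it is given by an invertible matrix
`M = [a, b; c, d]`, which acts on `ℙ¹(ℂ) = ℂ ∪ {∞}` by `t ↦ (a t + b) / (c t + d)`. -/

/-- The rational function `(a t + b) / (c t + d)`. -/
def mobius (M : GL (Fin 2) ℂ) : RatFunc ℂ :=
  (RatFunc.C (M 0 0) * RatFunc.X + RatFunc.C (M 0 1)) /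
    (RatFunc.C (M 1 0) * RatFunc.X + RatFunc.C (M 1 1))

/-- The composition `F ∘ S` where `S` is the Möbius transformation given by `M`. -/
def compMobius (F : RatFunc ℂ) (M : GL (Fin 2) ℂ) : RatFunc ℂ :=
  F.eval RatFunc.C (mobius M)

/-- The roots of `R` in `ℙ¹(ℂ)`: its complex roots, and also `∞` if `R` is a cubic. -/
def projRoots (R : ℂ[X]) : Set (OnePoint ℂ) :=
  {x | (∃ r : ℂ, R.IsRoot r ∧ x = (r : OnePoint ℂ)) ∨ (R.natDegree = 3 ∧ x = OnePoint.infty)}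

/-- The Möbius transformation given by `M` is an involution (an element of order two of `PGL₂(ℂ)`)
that permutes the roots of `R` in pairs, that is, maps the set of roots to itself and fixes none. -/
def IsPairingInvolution (R : ℂ[X]) (M : GL (Fin 2) ℂ) : Prop :=
  orderOf (Matrix.ProjGenLinGroup.mk M) = 2 ∧ ∀ x ∈ projRoots R, M • x ∈ projRoots R ∧ M • x ≠ x

end

end Goursat

/-! The heart is the case of one involution `S` with `F ∘ S = -F`. The roots fall into two orbits of
`S`, so `R = κ p q`, where the quadratic forms `p`, `q` vanish on one orbit each. Then `v = p / q`
is `S`-invariant of degree two and generates the fixed field of `S`, while `w = y / (√κ q)`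
satisfies `w ^ 2 = v`. Since `F` and the Wronskian of `q` and `p` both change sign, `F / y = N * w′`
with `N` invariant, hence rational in `v = w ^ 2` (`mem_adjoin_of_fixed`). The integrand is a
rational function of `w` times `w′`, and partial fractions integrate it by a rational function of
`w` and logarithms.

In general, the involutions act on four points as the three pairings, so `S₁ S₂ = S₃`
(`mk_mul_eq_of_isPairingInvolution`). Write `F` as the sum of `(F - F ∘ S₁) / 2` and `(F + F ∘ S₁) /
2`. The first half changes sign under `S₁`; the hypothesis says exactly that the second changes sign
under `S₂`. -/

namespace Goursat

open Polynomial
open scoped Differential IntermediateField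

noncomputable section

/-! ### Integrals of Liouville form -/

/-- `f` is the derivative of an element of `K` plus a linear combination, with constant
coefficients, of logarithmic derivatives of elements of `K`. -/
def IsLiouvilleForm {K : Type} [Field K] [Differential K] (f : K) : Prop :=
  ∃ (g : K) (n : ℕ) (c a : Fin n → K), (∀ i, (c i)′ = 0) ∧ (∀ i, a i ≠ 0) ∧
    f = g′ + ∑ i, c i * ((a i)′ / a i)

namespace IsLiouvilleForm

variable {K : Type} [Field K] [Differential K]

theorem deriv (g : K) : IsLiouvilleForm g′ :=
  ⟨g, 0, Fin.elim0, Fin.elim0, fun i => i.elim0, fun i => i.elim0, by simp⟩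

theorem zero : IsLiouvilleForm (0 : K) := by
  simpa using deriv (0 : K)

theorem logDeriv {a : K} (ha : a ≠ 0) : IsLiouvilleForm (a′ / a) :=
  ⟨0, 1, fun _ => 1, fun _ => a, fun _ => Derivation.map_one_eq_zero _, fun _ => ha, by simp⟩

theorem add {f g : K} (hf : IsLiouvilleForm f) (hg : IsLiouvilleForm g) :
    IsLiouvilleForm (f + g) := by
  obtain ⟨u, m, c, a, hc, ha, rfl⟩ := hf
  obtain ⟨v, n, d, b, hd, hb, rfl⟩ := hg
  refine ⟨u + v, m + n, Fin.append c d, Fin.append a b, fun i => ?_, fun i => ?_, ?_⟩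
  · induction i using Fin.addCases <;> simp [hc, hd]
  · induction i using Fin.addCases <;> simp [ha, hb]
  · simp only [map_add, Fin.sum_univ_add, Fin.append_left, Fin.append_right]
    ring

theorem const_mul {c f : K} (hc : c′ = 0) (hf : IsLiouvilleForm f) : IsLiouvilleForm (c * f) := by
  obtain ⟨u, m, d, a, hd, ha, rfl⟩ := hf
  refine ⟨c * u, m, fun i => c * d i, a, fun i => ?_, ha, ?_⟩
  · simp [Derivation.leibniz, hc, hd]
  · simp [Derivation.leibniz, hc, mul_add, Finset.mul_sum, mul_assoc]

end IsLiouvilleForm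

/-! ### Partial fractions and the integration of rational functions. -/

section RationalIntegrand

variable {k K : Type} [Field k] [Field K] [Algebra k K]

/-- The `k`-span of the partial fractions in `w`. -/
def partialFractions (k : Type) {K : Type} [Field k] [Field K] [Algebra k K] (w : K) :
    Submodule k K :=
  Submodule.span k (Set.range (fun n : ℕ => w ^ n) ∪
    Set.range fun p : k × ℕ => ((w - algebraMap k K p.1) ^ (p.2 + 1))⁻¹)

theorem pow_mem_partialFractions (w : K) (n : ℕ) : w ^ n ∈ partialFractions k w :=
  Submodule.subset_span (Or.inl ⟨n, rfl⟩)

theorem inv_pow_mem_partialFractions (w : K) (a : k) (n : ℕ) :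
    ((w - algebraMap k K a) ^ (n + 1))⁻¹ ∈ partialFractions k w :=
  Submodule.subset_span (Or.inr ⟨(a, n), rfl⟩)

/-- This allows a denominator to be built one linear factor at a time. Division lowers a power of
`w`; for `a = b` the order of the pole rises, and for `a ≠ b` the two poles are separated by the
resolvent identity. -/
theorem mul_inv_mem_partialFractions {w : K} (hw : ∀ a : k, w - algebraMap k K a ≠ 0) (b : k)
    {f : K} (hf : f ∈ partialFractions k w) :
    f * (w - algebraMap k K b)⁻¹ ∈ partialFractions k w := by
  have hb := hw b
  induction hf using Submodule.span_induction with
  | zero => simp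
  | add x y _ _ hx hy => rw [add_mul]; exact add_mem hx hy
  | smul c x _ hx => rw [smul_mul_assoc]; exact Submodule.smul_mem _ _ hx
  | mem x hx =>
    rcases hx with ⟨n, rfl⟩ | ⟨⟨a, n⟩, rfl⟩
    · induction n with
      | zero => simpa using inv_pow_mem_partialFractions w b 0
      | succ n ih =>
        have : w ^ (n + 1) * (w - algebraMap k K b)⁻¹ =
            w ^ n + b • (w ^ n * (w - algebraMap k K b)⁻¹) := by
          rw [Algebra.smul_def]; field_simp; ring
        simp only [this]
        exact add_mem (pow_mem_partialFractions w n) (Submodule.smul_mem _ _ ih)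
    · have ha := hw a
      by_cases hab : a = b
      · subst hab
        simpa [pow_succ, mul_assoc, mul_left_comm] using inv_pow_mem_partialFractions w a (n + 1)
      have hab' : algebraMap k K a - algebraMap k K b ≠ 0 := by
        rw [← map_sub]
        exact (_root_.map_ne_zero _).2 (sub_ne_zero.2 hab)
      induction n with
      | zero =>
        have : ((w - algebraMap k K a) ^ (0 + 1))⁻¹ * (w - algebraMap k K b)⁻¹ =
            (a - b)⁻¹ • (((w - algebraMap k K a) ^ (0 + 1))⁻¹ -
              ((w - algebraMap k K b) ^ (0 + 1))⁻¹) := by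
          rw [Algebra.smul_def, map_inv₀, map_sub]; field_simp; ring
        simp only [this]
        exact Submodule.smul_mem _ _ (sub_mem (inv_pow_mem_partialFractions w a 0)
          (inv_pow_mem_partialFractions w b 0))
      | succ n ih =>
        have : ((w - algebraMap k K a) ^ (n + 1 + 1))⁻¹ * (w - algebraMap k K b)⁻¹ =
            (a - b)⁻¹ • (((w - algebraMap k K a) ^ (n + 1 + 1))⁻¹ -
              ((w - algebraMap k K a) ^ (n + 1))⁻¹ * (w - algebraMap k K b)⁻¹) := by
          rw [Algebra.smul_def, map_inv₀, map_sub]; field_simp; ring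
        simp only [this]
        exact Submodule.smul_mem _ _ (sub_mem (inv_pow_mem_partialFractions w a (n + 1)) ih)

theorem aeval_mem_partialFractions (w : K) (r : k[X]) : aeval w r ∈ partialFractions k w := by
  rw [aeval_eq_sum_range]
  exact sum_mem fun i _ => Submodule.smul_mem _ _ (pow_mem_partialFractions w i)

theorem aeval_div_aeval_mem_partialFractions [IsAlgClosed k] {w : K}
    (hw : ∀ a : k, w - algebraMap k K a ≠ 0) (r s : k[X]) :
    aeval w r / aeval w s ∈ partialFractions k w := by
  have key : ∀ m : Multiset k, aeval w r * (aeval w (m.map fun a => X - C a).prod)⁻¹ ∈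
      partialFractions k w := by
    intro m
    induction m using Multiset.induction_on with
    | empty => simpa using aeval_mem_partialFractions w r
    | cons a m ih =>
      have := mul_inv_mem_partialFractions hw a ih
      simpa [mul_comm, mul_left_comm, mul_assoc] using this
  rw [(IsAlgClosed.splits s).eq_prod_roots, map_mul, aeval_C, div_eq_mul_inv, mul_inv,
    mul_left_comm, ← map_inv₀, ← Algebra.smul_def]
  exact Submodule.smul_mem _ _ (key _)

/-- The substitution `x = w` in the integral of a rational function. -/
theorem IsLiouvilleForm.aeval_div_aeval_mul_deriv [IsAlgClosed k] [CharZero K]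
    [Differential K] (hk : ∀ c : k, (algebraMap k K c)′ = 0) (w : K) (r s : k[X]) :
    IsLiouvilleForm (aeval w r / aeval w s * w′) := by
  -- A constant `w` gives the integrand zero. Otherwise `w` differs from every element of `k`, and
  -- no denominator below vanishes.
  by_cases hw' : w′ = 0
  · simpa [hw'] using IsLiouvilleForm.zero
  have hw : ∀ a : k, w - algebraMap k K a ≠ 0 := by
    intro a ha
    rw [sub_eq_zero] at ha
    exact hw' (ha ▸ hk a)
  have hn : ∀ n : ℕ, ((n : K) + 1) ≠ 0 := fun n => Nat.cast_add_one_ne_zero n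
  have hd : ∀ n : ℕ, (((n : K) + 1)⁻¹)′ = 0 := by
    intro n
    simp [Derivation.leibniz_inv]
  have hmem := aeval_div_aeval_mem_partialFractions hw r s
  generalize aeval w r / aeval w s = f at hmem ⊢
  induction hmem using Submodule.span_induction with
  | zero => simpa using IsLiouvilleForm.zero
  | add x y _ _ hx hy => rw [add_mul]; exact hx.add hy
  | smul c x _ hx => rw [smul_mul_assoc, Algebra.smul_def]; exact hx.const_mul (hk c)
  | mem x hx =>
    rcases hx with ⟨n, rfl⟩ | ⟨⟨a, n⟩, rfl⟩
    · convert (IsLiouvilleForm.deriv (w ^ (n + 1))).const_mul (hd n) using 1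
      have := hn n
      simp only [Derivation.leibniz_pow, nsmul_eq_mul, smul_eq_mul]
      push_cast
      field_simp
    · have ha := hw a
      have hwa : (w - algebraMap k K a)′ = w′ := by simp [hk]
      -- Only simple poles produce a logarithm.
      cases n with
      | zero =>
        convert IsLiouvilleForm.logDeriv ha using 1
        rw [hwa]; field_simp; simp
      | succ n =>
        convert (IsLiouvilleForm.deriv (((w - algebraMap k K a) ^ (n + 1))⁻¹)).const_mul
          (c := -((n : K) + 1)⁻¹) (by simpa using hd n) using 1
        have := hn n
        simp only [Derivation.leibniz_inv, Derivation.leibniz_pow, nsmul_eq_mul, smul_eq_mul, hwa]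
        push_cast
        field_simp
        simp [pow_succ]
        field_simp

end RationalIntegrand

/-! ### Adjoining logarithms -/

section Primitives

variable {K : Type} [Field K] [Differential K] {σ : Type}

/-- The ring homomorphism `a ↦ a + a′ ε` from `K` to the dual numbers over an extension of `K`. -/
def derivHom (K A : Type) [Field K] [Differential K] [CommRing A] [Algebra K A] :
    K →+* DualNumber A where
  toFun a := TrivSqZeroExt.inl (algebraMap K A a) + TrivSqZeroExt.inr (algebraMap K A a′)
  map_one' := by ext <;> simp
  map_zero' := by ext <;> simp
  map_add' x y := by ext <;> simp [-DualNumber.inr_eq_smul_eps]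
  map_mul' x y := by ext <;> simp [Derivation.leibniz, -DualNumber.inr_eq_smul_eps, mul_comm]

/-- The ring homomorphism `p ↦ p + p′ ε` for the derivation of `K[X₁, …]` that extends that of `K`
and maps `Xᵢ` to `b i`. -/
def dualNumberHom (b : σ → K) :
    MvPolynomial σ K →+* DualNumber (FractionRing (MvPolynomial σ K)) :=
  MvPolynomial.eval₂Hom (derivHom K _) fun i =>
    TrivSqZeroExt.inl (algebraMap (MvPolynomial σ K) _ (MvPolynomial.X i)) +
      TrivSqZeroExt.inr (algebraMap K _ (b i))

theorem dualNumberHom_C (b : σ → K) (a : K) :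
    dualNumberHom b (MvPolynomial.C a) =
      TrivSqZeroExt.inl (algebraMap K _ a) + TrivSqZeroExt.inr (algebraMap K _ a′) :=
  MvPolynomial.eval₂Hom_C _ _ _

theorem dualNumberHom_X (b : σ → K) (i : σ) :
    dualNumberHom b (MvPolynomial.X i) =
      TrivSqZeroExt.inl (algebraMap (MvPolynomial σ K) _ (MvPolynomial.X i)) +
        TrivSqZeroExt.inr (algebraMap K _ (b i)) :=
  MvPolynomial.eval₂Hom_X' _ _ _

/-- Both ring homomorphisms agree on constants and variables. Having the identity as first component
is what makes the second component satisfy the Leibniz rule, and what makes nonzero polynomials map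
to units, so that the map extends to fractions. -/
theorem fst_dualNumberHom (b : σ → K) (p : MvPolynomial σ K) :
    (dualNumberHom b p).fst = algebraMap _ (FractionRing (MvPolynomial σ K)) p := by
  have : (TrivSqZeroExt.fstHom (FractionRing (MvPolynomial σ K)) (FractionRing (MvPolynomial σ K))
      (FractionRing (MvPolynomial σ K))).toRingHom.comp (dualNumberHom b) =
      algebraMap _ (FractionRing (MvPolynomial σ K)) := by
    apply MvPolynomial.ringHom_ext
    · intro r
      simp [dualNumberHom_C, IsScalarTower.algebraMap_apply K (MvPolynomial σ K)
        (FractionRing (MvPolynomial σ K)), MvPolynomial.algebraMap_eq]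
    · intro i
      simp [dualNumberHom_X]
  exact congr($this p)

theorem isUnit_dualNumberHom (b : σ → K) (p : nonZeroDivisors (MvPolynomial σ K)) :
    IsUnit (dualNumberHom b p) := by
  rw [TrivSqZeroExt.isUnit_iff_isUnit_fst, fst_dualNumberHom]
  exact IsLocalization.map_units _ p

/-- The extension of `dualNumberHom` to the fraction field. -/
def dualNumberHomFrac (b : σ → K) : FractionRing (MvPolynomial σ K) →+*
    DualNumber (FractionRing (MvPolynomial σ K)) :=
  IsLocalization.lift (isUnit_dualNumberHom b)

theorem dualNumberHomFrac_algebraMap (b : σ → K) (p : MvPolynomial σ K) :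
    dualNumberHomFrac b (algebraMap _ _ p) = dualNumberHom b p :=
  IsLocalization.lift_eq _ _

theorem fst_dualNumberHomFrac (b : σ → K) (x : FractionRing (MvPolynomial σ K)) :
    (dualNumberHomFrac b x).fst = x := by
  have : (TrivSqZeroExt.fstHom (FractionRing (MvPolynomial σ K)) (FractionRing (MvPolynomial σ K))
      (FractionRing (MvPolynomial σ K))).toRingHom.comp (dualNumberHomFrac b) =
      RingHom.id _ := by
    apply IsLocalization.ringHom_ext (nonZeroDivisors (MvPolynomial σ K))
    refine RingHom.ext fun p => ?_
    simp [dualNumberHomFrac_algebraMap, fst_dualNumberHom]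
  exact congr($this x)

/-- The derivation of `K(X₁, …)` that extends that of `K` and maps `Xᵢ` to `b i`. -/
@[reducible]
def differentialOfPrimitives (b : σ → K) : Differential (FractionRing (MvPolynomial σ K)) :=
  differentialOfLeibniz (fun x => (dualNumberHomFrac b x).snd) (fun f g => by simp)
    (fun f g => by simp [fst_dualNumberHomFrac, mul_comm])

theorem deriv_algebraMap_primitives (b : σ → K) (a : K) :
    letI := differentialOfPrimitives b
    (algebraMap K (FractionRing (MvPolynomial σ K)) a)′ = algebraMap K _ a′ := by
  change (dualNumberHomFrac b _).snd = _
  rw [IsScalarTower.algebraMap_apply K (MvPolynomial σ K), dualNumberHomFrac_algebraMap,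
    MvPolynomial.algebraMap_eq, dualNumberHom_C]
  simp [-DualNumber.inr_eq_smul_eps]

theorem deriv_X_primitives (b : σ → K) (i : σ) :
    letI := differentialOfPrimitives b
    (algebraMap (MvPolynomial σ K) (FractionRing (MvPolynomial σ K)) (MvPolynomial.X i))′ =
      algebraMap K _ (b i) := by
  change (dualNumberHomFrac b _).snd = _
  rw [dualNumberHomFrac_algebraMap, dualNumberHom_X]
  simp [-DualNumber.inr_eq_smul_eps]

theorem adjoin_X_fractionRing (K σ : Type) [Field K] :
    IntermediateField.adjoin K (Set.range fun i : σ =>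
      algebraMap (MvPolynomial σ K) (FractionRing (MvPolynomial σ K)) (MvPolynomial.X i)) = ⊤ := by
  rw [eq_top_iff]
  intro x _
  obtain ⟨p, q, _, rfl⟩ := IsFractionRing.div_surjective (A := MvPolynomial σ K) x
  have h : ∀ p : MvPolynomial σ K, algebraMap (MvPolynomial σ K)
      (FractionRing (MvPolynomial σ K)) p ∈ IntermediateField.adjoin K (Set.range fun i : σ =>
      algebraMap (MvPolynomial σ K) (FractionRing (MvPolynomial σ K)) (MvPolynomial.X i)) := by
    intro p
    induction p using MvPolynomial.induction_on with
    | C a =>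
      rw [← MvPolynomial.algebraMap_eq, ← IsScalarTower.algebraMap_apply]
      exact IntermediateField.algebraMap_mem _ a
    | add p q hp hq => rw [map_add]; exact add_mem hp hq
    | mul_X p i hp =>
      rw [map_mul]
      exact mul_mem hp (IntermediateField.subset_adjoin _ _ ⟨i, rfl⟩)
  exact div_mem (h p) (h q)

end Primitives

/-- Each logarithm is adjoined as a new independent variable `θ i` with derivative `(a i)′ / a i`.
This is consistent even if `K` already contains such a logarithm. Stage `m` of the tower is
generated by the `θ i` with `i < m`. -/
theorem IsLiouvilleForm.hasElementaryIntegral {K : Type} [Field K] [Differential K] {f : K}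
    (hf : IsLiouvilleForm f) : HasElementaryIntegral f := by
  obtain ⟨g, n, c, a, hc, ha, rfl⟩ := hf
  let b : Fin n → K := fun i => (a i)′ / a i
  let := differentialOfPrimitives b
  let L := FractionRing (MvPolynomial (Fin n) K)
  let θ : Fin n → L := fun i => algebraMap (MvPolynomial (Fin n) K) L (MvPolynomial.X i)
  have hθ : ∀ i, (θ i)′ = algebraMap K L (b i) := deriv_X_primitives b
  have hDA : DifferentialAlgebra K L := ⟨deriv_algebraMap_primitives b⟩
  refine ⟨L, inferInstance, inferInstance, inferInstance, hDA,
    ⟨n, fun m => IntermediateField.adjoin K (θ '' {i | (i : ℕ) < m}), ?_, ?_, ?_⟩,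
    algebraMap K L g + ∑ i, algebraMap K L (c i) * θ i, ?_⟩
  · simp
  · have : {i : Fin n | (i : ℕ) < n} = Set.univ := by ext i; simp
    simp only [this, Set.image_univ]
    exact adjoin_X_fractionRing K (Fin n)
  · intro m hm
    refine ⟨θ ⟨m, hm⟩, ?_, Or.inr (Or.inr ⟨algebraMap K L (a ⟨m, hm⟩),
      IntermediateField.algebraMap_mem _ _, by simpa using ha _, ?_⟩)⟩
    · have : {i : Fin n | (i : ℕ) < m + 1} = {i : Fin n | (i : ℕ) < m} ∪ {⟨m, hm⟩} := by
        ext i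
        simp [Fin.ext_iff]
        omega
      simp only [← IntermediateField.adjoin_union, this, Set.image_union,
        Set.image_singleton]
    · rw [hθ, deriv_algebraMap, map_div₀]
  · simp [deriv_algebraMap, hc, hθ, b, Derivation.leibniz]

/-! ### Composition with a Möbius transformation -/

section Mobius

variable (M N : GL (Fin 2) ℂ)

theorem det_entries_ne_zero : M 0 0 * M 1 1 - M 0 1 * M 1 0 ≠ 0 := by
  have := M.det_ne_zero
  rwa [Matrix.det_fin_two] at this

theorem C_mul_X_add_C_eq_zero_iff {a b : ℂ} :
    RatFunc.C a * RatFunc.X + RatFunc.C b = 0 ↔ a = 0 ∧ b = 0 := by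
  constructor
  · intro h
    rw [← RatFunc.algebraMap_C, ← RatFunc.algebraMap_C, ← RatFunc.algebraMap_X, ← map_mul,
      ← map_add, map_eq_zero_iff _ (RatFunc.algebraMap_injective ℂ)] at h
    exact ⟨by simpa using congr(coeff $h 1), by simpa using congr(coeff $h 0)⟩
  · rintro ⟨rfl, rfl⟩
    simp

theorem mobius_denom_ne_zero :
    RatFunc.C (M 1 0) * RatFunc.X + RatFunc.C (M 1 1) ≠ 0 := by
  rw [Ne, C_mul_X_add_C_eq_zero_iff]
  rintro ⟨h, h'⟩
  exact det_entries_ne_zero M (by simp [h, h'])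

theorem transcendental_mobius : Transcendental ℂ (mobius M) := by
  apply RatFunc.transcendental_of_ne_C
  rintro ⟨k, hk⟩
  rw [mobius, div_eq_iff (mobius_denom_ne_zero M), ← sub_eq_zero] at hk
  have : RatFunc.C (M 0 0 - k * M 1 0) * RatFunc.X + RatFunc.C (M 0 1 - k * M 1 1) = 0 := by
    simp only [map_sub, map_mul]
    linear_combination hk
  obtain ⟨h, h'⟩ := C_mul_X_add_C_eq_zero_iff.1 this
  apply det_entries_ne_zero M
  linear_combination M 1 1 * h - M 1 0 * h'

/-- The endomorphism `F ↦ F ∘ S` of `ℂ(t)`, where `S` is the Möbius transformation given by `M`. -/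
def mobiusHom : RatFunc ℂ →ₐ[ℂ] RatFunc ℂ :=
  RatFunc.liftAlgHom (aeval (mobius M)) <| nonZeroDivisors_le_comap_nonZeroDivisors_of_injective _
    (transcendental_iff_injective.1 (transcendental_mobius M))

theorem mobiusHom_algebraMap (p : ℂ[X]) :
    mobiusHom M (algebraMap ℂ[X] (RatFunc ℂ) p) = aeval (mobius M) p := by
  simpa [mobiusHom] using RatFunc.liftAlgHom_apply_div (φ := aeval (mobius M))
    (hφ := nonZeroDivisors_le_comap_nonZeroDivisors_of_injective _
    (transcendental_iff_injective.1 (transcendental_mobius M))) p 1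

theorem mobiusHom_X : mobiusHom M RatFunc.X = mobius M := by
  rw [← RatFunc.algebraMap_X, mobiusHom_algebraMap, aeval_X]

theorem mobiusHom_C (c : ℂ) : mobiusHom M (RatFunc.C c) = RatFunc.C c :=
  (mobiusHom M).commutes c

theorem compMobius_eq (F : RatFunc ℂ) : compMobius F M = mobiusHom M F := by
  conv_rhs => rw [← RatFunc.num_div_denom F]
  rw [map_div₀, mobiusHom_algebraMap, mobiusHom_algebraMap]
  rfl

theorem algHom_ext_of_X {σ τ : RatFunc ℂ →ₐ[ℂ] RatFunc ℂ} (h : σ RatFunc.X = τ RatFunc.X) :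
    σ = τ := by
  have key : ∀ p : ℂ[X], σ (algebraMap ℂ[X] (RatFunc ℂ) p) = τ (algebraMap ℂ[X] (RatFunc ℂ) p) := by
    intro p
    rw [← RatFunc.aeval_X_left_eq_algebraMap, ← aeval_algHom_apply, ← aeval_algHom_apply, h]
  ext F
  rw [← RatFunc.num_div_denom F, map_div₀, map_div₀, key, key]

/-- Substitution is contravariant, whence the reversed product. -/
theorem mobiusHom_mobiusHom (F : RatFunc ℂ) :
    mobiusHom M (mobiusHom N F) = mobiusHom (N * M) F := by
  suffices (mobiusHom M).comp (mobiusHom N) = mobiusHom (N * M) from congr($this F)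
  apply algHom_ext_of_X
  rw [AlgHom.comp_apply, mobiusHom_X, mobiusHom_X]
  have h := mobius_denom_ne_zero M
  have h' := mobius_denom_ne_zero (N * M)
  have h'' := (_root_.map_ne_zero (mobiusHom M)).2 (mobius_denom_ne_zero N)
  simp only [mobius, map_div₀, map_add, map_mul, mobiusHom_C, mobiusHom_X] at h'' ⊢
  simp only [Matrix.GeneralLinearGroup.coe_mul, Matrix.mul_apply, Fin.sum_univ_two, map_add,
    map_mul] at h' ⊢
  rw [div_eq_div_iff h'' h']
  generalize hD : RatFunc.C (M 1 0) * RatFunc.X + RatFunc.C (M 1 1) = D at h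
  field_simp
  rw [← hD]
  ring

theorem mobiusHom_eq_of_mk_eq {M N : GL (Fin 2) ℂ}
    (h : Matrix.ProjGenLinGroup.mk M = Matrix.ProjGenLinGroup.mk N) :
    mobiusHom M = mobiusHom N := by
  obtain ⟨u, rfl⟩ := Matrix.ProjGenLinGroup.mk_eq_mk_iff.1 h
  apply algHom_ext_of_X
  have hM := mobius_denom_ne_zero M
  have hN := mobius_denom_ne_zero (M * .scalar _ u)
  rw [mobiusHom_X, mobiusHom_X, mobius, mobius, div_eq_div_iff hM hN]
  simp [Matrix.mul_apply, Fin.sum_univ_two]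
  ring

/-- A Möbius transformation of order two is given by a matrix of trace zero. -/
theorem apply_one_one_of_orderOf_eq_two {M : GL (Fin 2) ℂ}
    (h : orderOf (Matrix.ProjGenLinGroup.mk M) = 2) : M 1 1 = -M 0 0 := by
  have h1 : Matrix.ProjGenLinGroup.mk M ≠ 1 := by
    intro h1
    simp [h1] at h
  have h2 : Matrix.ProjGenLinGroup.mk 1 = Matrix.ProjGenLinGroup.mk (M * M) := by
    rw [map_mul, ← pow_two, orderOf_dvd_iff_pow_eq_one.1 h.dvd, map_one]
  obtain ⟨u, hu⟩ := Matrix.ProjGenLinGroup.mk_eq_mk_iff.1 h2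
  have e : ∀ i j, (1 * Matrix.GeneralLinearGroup.scalar (Fin 2) u : GL (Fin 2) ℂ) i j =
    (M * M) i j := fun i j => by rw [hu]
  have e00 := e 0 0
  have e01 := e 0 1
  have e10 := e 1 0
  have e11 := e 1 1
  simp [Matrix.mul_apply, Fin.sum_univ_two] at e00 e01 e10 e11
  -- The square of `M` is scalar, so its entries give `(a + d) b = (a + d) c = (a + d) (a - d) = 0`.
  -- With nonzero trace, `M` itself would be scalar.
  by_contra hne
  have hs : M 0 0 + M 1 1 ≠ 0 := fun h0 => hne (by linear_combination h0)
  have hb : M 0 1 = 0 := by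
    refine (mul_eq_zero.1 (?_ : (M 0 0 + M 1 1) * M 0 1 = 0)).resolve_left hs
    linear_combination -e01
  have hc : M 1 0 = 0 := by
    refine (mul_eq_zero.1 (?_ : (M 0 0 + M 1 1) * M 1 0 = 0)).resolve_left hs
    linear_combination -e10
  have hd : M 0 0 - M 1 1 = 0 := by
    refine (mul_eq_zero.1 (?_ : (M 0 0 + M 1 1) * (M 0 0 - M 1 1) = 0)).resolve_left hs
    linear_combination -e00 + e11
  apply h1
  rw [Matrix.ProjGenLinGroup.mk_eq_one, Matrix.GeneralLinearGroup.center_eq_range_scalar]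
  have ha : M 0 0 ≠ 0 := fun ha => by
    apply hs
    linear_combination 2 * ha - hd
  refine ⟨Units.mk0 _ ha, ?_⟩
  ext i j
  fin_cases i <;> fin_cases j <;> simp [hb, hc]
  linear_combination hd

end Mobius

/-! ### The four roots and the involutions that permute them in pairs -/

section FourPoints

variable {α : Type} [DecidableEq α]

theorem _root_.Finset.eq_of_card_eq_four {s : Finset α} (hs : s.card = 4) {a b c d : α} (ha : a ∈ s)
    (hb : b ∈ s) (hc : c ∈ s) (hd : d ∈ s) (hab : a ≠ b) (hac : a ≠ c) (had : a ≠ d) (hbc : b ≠ c)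
    (hbd : b ≠ d) (hcd : c ≠ d) : s = {a, b, c, d} := by
  symm
  apply Finset.eq_of_subset_of_card_le
  · intro x hx
    simp only [Finset.mem_insert, Finset.mem_singleton] at hx
    rcases hx with rfl | rfl | rfl | rfl <;> assumption
  · simp [hs, hab, hac, had, hbc, hbd, hcd]

/-- `f` permutes the elements of `s` in pairs. -/
def IsPairing (s : Finset α) (f : α → α) : Prop :=
  ∀ x ∈ s, f x ∈ s ∧ f x ≠ x ∧ f (f x) = x

variable {s : Finset α} {f g h : α → α}

/-- An involution carries the complement of the orbit `{x, f x}` to itself, so two orbits exhaust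
four points. -/
theorem IsPairing.eq_insert (hs : s.card = 4) (hf : IsPairing s f) {x y : α} (hx : x ∈ s)
    (hy : y ∈ s) (hyx : y ≠ x) (hyf : y ≠ f x) : s = {x, f x, y, f y} := by
  apply Finset.eq_of_card_eq_four hs hx (hf x hx).1 hy (hf y hy).1 <;> grind [IsPairing]

/-- Once one pair is known, the two remaining points must be exchanged. -/
theorem IsPairing.eqOn_of_eq (hs : s.card = 4) (hf : IsPairing s f) (hg : IsPairing s g) {x : α}
    (hx : x ∈ s) (hfg : f x = g x) {y : α} (hy : y ∈ s) : f y = g y := by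
  by_cases hyx : y = x
  · rw [hyx, hfg]
  by_cases hyf : y = f x
  · rw [hyf, (hf x hx).2.2, hfg, (hg x hx).2.2]
  have h1 := hf.eq_insert hs hx hy hyx hyf
  have h2 := (hg y hy).1
  rw [h1] at h2
  simp only [Finset.mem_insert, Finset.mem_singleton] at h2
  grind [IsPairing]

/-- The product of two distinct pairings of four points is the third one. -/
theorem IsPairing.comp_eq (hs : s.card = 4) (hf : IsPairing s f) (hg : IsPairing s g)
    (hh : IsPairing s h) (hfg : ∃ x ∈ s, f x ≠ g x) (hfh : ∃ x ∈ s, f x ≠ h x)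
    (hgh : ∃ x ∈ s, g x ≠ h x) {x : α} (hx : x ∈ s) : f (g x) = h x := by
  have h1 : f x ≠ g x := fun e => by
    obtain ⟨y, hy, hne⟩ := hfg
    exact hne (hf.eqOn_of_eq hs hg hx e hy)
  have h2 : f x ≠ h x := fun e => by
    obtain ⟨y, hy, hne⟩ := hfh
    exact hne (hf.eqOn_of_eq hs hh hx e hy)
  have h3 : g x ≠ h x := fun e => by
    obtain ⟨y, hy, hne⟩ := hgh
    exact hne (hg.eqOn_of_eq hs hh hx e hy)
  -- The four points are `x`, `f x`, `g x`, `h x`. Injectivity and the absence of fixed points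
  -- exclude the first three as values of `f (g x)`.
  have h4 := Finset.eq_of_card_eq_four hs hx (hf x hx).1 (hg x hx).1 (hh x hx).1
    (hf x hx).2.1.symm (hg x hx).2.1.symm (hh x hx).2.1.symm h1 h2 h3
  have h5 := (hf _ (hg x hx).1).1
  rw [h4] at h5
  simp only [Finset.mem_insert, Finset.mem_singleton] at h5
  grind [IsPairing]

end FourPoints

/-- The polynomial of degree at most one that vanishes at a given point of `ℙ¹(ℂ)`. -/
def linearForm : OnePoint ℂ → ℂ[X]
  | none => 1
  | some r => X - C r

@[simp] theorem linearForm_infty : linearForm OnePoint.infty = 1 := rfl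

@[simp] theorem linearForm_coe (r : ℂ) : linearForm r = X - C r := rfl

/-- The point `∞` contributes the factor `1`, so cubics and quartics can be treated alike from here
on. -/
theorem exists_finset_projRoots {R : ℂ[X]} (hdeg : R.natDegree = 3 ∨ R.natDegree = 4)
    (hsimple : R.Separable) : ∃ s : Finset (OnePoint ℂ), s.card = 4 ∧
      (∀ x, x ∈ s ↔ x ∈ projRoots R) ∧ R = C R.leadingCoeff * ∏ x ∈ s, linearForm x := by
  classical
  have hR : R ≠ 0 := hsimple.ne_zero
  have hcard : R.roots.card = R.natDegree := splits_iff_card_roots.1 (IsAlgClosed.splits R)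
  have hnd : R.roots.Nodup := nodup_roots hsimple
  let t : Finset ℂ := ⟨R.roots, hnd⟩
  have ht : t.card = R.natDegree := hcard
  have hmem : ∀ r, r ∈ t ↔ R.IsRoot r := fun r => mem_roots hR
  have hprod : R = C R.leadingCoeff * ∏ r ∈ t, (X - C r) :=
    (C_leadingCoeff_mul_prod_multiset_X_sub_C hcard).symm
  let s : Finset (OnePoint ℂ) := t.map ⟨((↑) : ℂ → OnePoint ℂ), OnePoint.coe_injective⟩
  have hs : s.card = R.natDegree := by rw [Finset.card_map, ht]
  have hinf : OnePoint.infty ∉ s := by simp [s]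
  have hsprod : ∏ x ∈ s, linearForm x = ∏ r ∈ t, (X - C r) := by
    simp [s, Finset.prod_map]
  rcases hdeg with hdeg | hdeg
  · refine ⟨insert OnePoint.infty s, ?_, ?_, ?_⟩
    · rw [Finset.card_insert_of_notMem hinf, hs, hdeg]
    · intro x
      simp [projRoots, s, hmem, hdeg, eq_comm, or_comm]
    · rw [Finset.prod_insert hinf, linearForm_infty, one_mul, hsprod]
      exact hprod
  · refine ⟨s, by rw [hs, hdeg], ?_, by rw [hsprod]; exact hprod⟩
    intro x
    simp [projRoots, s, hmem, hdeg, eq_comm]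

theorem scalar_smul_onePoint (u : ℂˣ) (x : OnePoint ℂ) :
    Matrix.GeneralLinearGroup.scalar (Fin 2) u • x = x := by
  cases x with
  | infty => simp [OnePoint.smul_infty_eq_ite]
  | coe c => simp [OnePoint.smul_some_eq_ite]

theorem smul_eq_of_mk_eq {M N : GL (Fin 2) ℂ}
    (h : Matrix.ProjGenLinGroup.mk M = Matrix.ProjGenLinGroup.mk N) (x : OnePoint ℂ) :
    M • x = N • x := by
  obtain ⟨u, rfl⟩ := Matrix.ProjGenLinGroup.mk_eq_mk_iff.1 h
  rw [mul_smul, scalar_smul_onePoint]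

/-- Two Möbius transformations that agree at four points are equal. -/
theorem mk_eq_mk_of_smul_eq {M N : GL (Fin 2) ℂ} {s : Finset (OnePoint ℂ)} (hs : s.card = 4)
    (h : ∀ x ∈ s, M • x = N • x) :
    Matrix.ProjGenLinGroup.mk M = Matrix.ProjGenLinGroup.mk N := by
  classical
  rw [← inv_mul_eq_one, ← map_inv, ← map_mul, Matrix.ProjGenLinGroup.mk_eq_one,
    Matrix.GeneralLinearGroup.mem_center_iff_val_mem_range_scalar,
    ← Matrix.GeneralLinearGroup.fixpointPolynomial_eq_zero_iff]
  set g := M⁻¹ * N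
  have hg : ∀ x ∈ s, g • x = x := by
    intro x hx
    rw [mul_smul, ← h x hx, inv_smul_smul]
  -- At most one of the four fixed points is `∞`; the other three would be roots of the fixed-point
  -- polynomial, of degree at most two, unless it is zero.
  let t : Finset ℂ := s.preimage (↑) OnePoint.coe_injective.injOn
  have ht : 3 ≤ t.card := by
    have : s ⊆ insert OnePoint.infty (t.map ⟨((↑) : ℂ → OnePoint ℂ), OnePoint.coe_injective⟩) := by
      intro x hx
      cases x with
      | infty => simp
      | coe c => simpa [t] using hx
    have := Finset.card_le_card this
    have h' := Finset.card_insert_le OnePoint.infty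
      (t.map ⟨((↑) : ℂ → OnePoint ℂ), OnePoint.coe_injective⟩)
    rw [Finset.card_map] at h'
    omega
  by_contra hne
  have hroots : t.val ⊆ g.fixpointPolynomial.roots := by
    intro c hc
    rw [mem_roots hne, IsRoot.def, ← coe_aeval_eq_eval,
      Matrix.GeneralLinearGroup.fixpointPolynomial_aeval_eq_zero_iff]
    exact hg c (by simpa [t] using hc)
  have h1 := Polynomial.card_le_degree_of_subset_roots hroots
  have h2 : g.fixpointPolynomial.natDegree ≤ 2 := by
    unfold Matrix.GeneralLinearGroup.fixpointPolynomial
    compute_degree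
  omega

theorem IsPairingInvolution.isPairing {R : ℂ[X]} {M : GL (Fin 2) ℂ} (h : IsPairingInvolution R M)
    {s : Finset (OnePoint ℂ)} (hs : ∀ x, x ∈ s ↔ x ∈ projRoots R) :
    IsPairing s fun x => M • x := by
  intro x hx
  have h1 := h.2 x ((hs x).1 hx)
  refine ⟨(hs _).2 h1.1, h1.2, ?_⟩
  have h2 : Matrix.ProjGenLinGroup.mk (M * M) = Matrix.ProjGenLinGroup.mk 1 := by
    rw [map_mul, ← pow_two, orderOf_dvd_iff_pow_eq_one.1 h.1.dvd, map_one]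
  have := smul_eq_of_mk_eq h2 x
  rwa [mul_smul, one_smul] at this

/-- The three pairing involutions, together with the identity, form a group. -/
theorem mk_mul_eq_of_isPairingInvolution {R : ℂ[X]} (hdeg : R.natDegree = 3 ∨ R.natDegree = 4)
    (hsimple : R.Separable) {M₁ M₂ M₃ : GL (Fin 2) ℂ} (h₁ : IsPairingInvolution R M₁)
    (h₂ : IsPairingInvolution R M₂) (h₃ : IsPairingInvolution R M₃)
    (h₁₂ : Matrix.ProjGenLinGroup.mk M₁ ≠ Matrix.ProjGenLinGroup.mk M₂)
    (h₁₃ : Matrix.ProjGenLinGroup.mk M₁ ≠ Matrix.ProjGenLinGroup.mk M₃)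
    (h₂₃ : Matrix.ProjGenLinGroup.mk M₂ ≠ Matrix.ProjGenLinGroup.mk M₃) :
    Matrix.ProjGenLinGroup.mk (M₁ * M₂) = Matrix.ProjGenLinGroup.mk M₃ := by
  classical
  obtain ⟨s, hcard, hs, -⟩ := exists_finset_projRoots hdeg hsimple
  have key : ∀ {M N : GL (Fin 2) ℂ},
      Matrix.ProjGenLinGroup.mk M ≠ Matrix.ProjGenLinGroup.mk N → ∃ x ∈ s, M • x ≠ N • x := by
    intro M N hne
    by_contra! hall
    exact hne (mk_eq_mk_of_smul_eq hcard hall)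
  refine mk_eq_mk_of_smul_eq hcard fun x hx => ?_
  rw [mul_smul]
  exact (h₁.isPairing hs).comp_eq hcard (h₂.isPairing hs) (h₃.isPairing hs) (key h₁₂) (key h₁₃)
    (key h₂₃) hx

/-- The polynomial with roots `r` and `S r`, where `S` is the Möbius transformation of order two
given by `M`. -/
def pairPoly (M : GL (Fin 2) ℂ) (r : ℂ) : ℂ[X] :=
  (X - C r) * (C (M 1 0 * r - M 0 0) * X - C (M 0 0 * r + M 0 1))

/-- If `S r` is finite, the second factor of `pairPoly` is a nonzero multiple of `X - S r`. If `S r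
= ∞`, its leading coefficient vanishes, and its constant term does not because `M` is invertible. -/
theorem exists_pairPoly_of_coe {M : GL (Fin 2) ℂ} (hM : M 1 1 = -M 0 0) {r : ℂ} :
    ∃ κ : ℂ, linearForm r * linearForm (M • (r : OnePoint ℂ)) = C κ * pairPoly M r := by
  rw [OnePoint.smul_some_eq_ite, hM, ← sub_eq_add_neg]
  split_ifs with h
  · have h0 : M 0 0 * r + M 0 1 ≠ 0 := by
      intro h0
      apply det_entries_ne_zero M
      rw [hM]
      linear_combination M 0 0 * h - M 1 0 * h0
    refine ⟨-(M 0 0 * r + M 0 1)⁻¹, ?_⟩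
    rw [pairPoly, h, linearForm_infty, linearForm_coe]
    have := congrArg C (inv_mul_cancel₀ h0)
    rw [C_mul, C_1] at this
    simp only [C_neg, C_0]
    linear_combination (C r - X) * this
  · refine ⟨(M 1 0 * r - M 0 0)⁻¹, ?_⟩
    have := congrArg C (inv_mul_cancel₀ h)
    rw [C_mul, C_1] at this
    rw [pairPoly, linearForm_coe, linearForm_coe, div_eq_mul_inv, C_mul]
    linear_combination (C r - X) * X * this

theorem exists_pairPoly {M : GL (Fin 2) ℂ} (hM : M 1 1 = -M 0 0) {x : OnePoint ℂ}
    (hx : M • x ≠ x) (hx' : M • M • x = x) :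
    ∃ κ r : ℂ, linearForm x * linearForm (M • x) = C κ * pairPoly M r := by
  cases x with
  | coe r =>
    obtain ⟨κ, hκ⟩ := exists_pairPoly_of_coe hM (r := r)
    exact ⟨κ, r, hκ⟩
  -- The partner of `∞` is finite and is sent back to `∞`, so the pair is described from the
  -- partner's side.
  | infty =>
    obtain ⟨r, hr⟩ := OnePoint.ne_infty_iff_exists.1 hx
    obtain ⟨κ, hκ⟩ := exists_pairPoly_of_coe hM (r := r)
    rw [hr, hx', ← hr] at hκ
    exact ⟨κ, r, by rw [← hκ, ← hr, mul_comm]⟩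

/-- A pairing involution exhibits `R` as a product of two quadratic forms. -/
theorem IsPairingInvolution.exists_eq_mul {R : ℂ[X]} (hdeg : R.natDegree = 3 ∨ R.natDegree = 4)
    (hsimple : R.Separable) {M : GL (Fin 2) ℂ} (h : IsPairingInvolution R M) :
    ∃ κ r s : ℂ, R = C κ * (pairPoly M r * pairPoly M s) := by
  classical
  have hM := apply_one_one_of_orderOf_eq_two h.1
  obtain ⟨t, hcard, ht, hprod⟩ := exists_finset_projRoots hdeg hsimple
  have hp := h.isPairing ht
  obtain ⟨x, hx⟩ : t.Nonempty := Finset.card_pos.1 (by omega)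
  obtain ⟨y, hy, hyn⟩ : ∃ y ∈ t, y ∉ ({x, M • x} : Finset (OnePoint ℂ)) :=
    Finset.exists_mem_notMem_of_card_lt_card
      (lt_of_le_of_lt Finset.card_le_two (by omega))
  simp only [Finset.mem_insert, Finset.mem_singleton, not_or] at hyn
  have heq := hp.eq_insert hcard hx hy hyn.1 hyn.2
  obtain ⟨κ₁, r, hr⟩ := exists_pairPoly hM (hp x hx).2.1 (hp x hx).2.2
  obtain ⟨κ₂, s, hs⟩ := exists_pairPoly hM (hp y hy).2.1 (hp y hy).2.2
  refine ⟨R.leadingCoeff * κ₁ * κ₂, r, s, ?_⟩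
  have hprod' : ∏ z ∈ t, linearForm z =
      (linearForm x * linearForm (M • x)) * (linearForm y * linearForm (M • y)) := by
    rw [heq, Finset.prod_insert, Finset.prod_insert, Finset.prod_insert, Finset.prod_singleton]
    · ring
    all_goals
      simp only [Finset.mem_insert, Finset.mem_singleton]
      grind [IsPairing]
  rw [hprod', hr, hs] at hprod
  refine hprod.trans ?_
  simp only [C_mul]
  ring

/-! ### The quadratic subfield fixed by an involution -/

/-- If `p / q` has degree at most two and is fixed by the non-trivial endomorphism `σ` of `ℂ(t)`,
then `p / q` generates the fixed field of `σ`. -/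
theorem mem_adjoin_of_fixed {p q : ℂ[X]} (hp : p.natDegree ≤ 2) (hq : q.natDegree ≤ 2) {r : ℂ}
    (hqr : q.eval r = 0) (hpr : p.eval r ≠ 0) (hq0 : q ≠ 0) {σ : RatFunc ℂ →ₐ[ℂ] RatFunc ℂ}
    {v : RatFunc ℂ} (hv : v = algebraMap ℂ[X] (RatFunc ℂ) p / algebraMap ℂ[X] (RatFunc ℂ) q)
    (hσv : σ v = v) (hσX : σ RatFunc.X ≠ RatFunc.X) {N : RatFunc ℂ} (hN : σ N = N) :
    N ∈ ℂ⟮v⟯ := by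
  have hq' : algebraMap ℂ[X] (RatFunc ℂ) q ≠ 0 := RatFunc.algebraMap_ne_zero hq0
  let v' : ℂ⟮v⟯ := IntermediateField.AdjoinSimple.gen ℂ v
  -- The variable `t` is a root of `v q - p`, so it has degree at most two over `ℂ(v)`. The
  -- polynomial is nonzero because its value at `r` is `-p(r)`.
  let P : ℂ⟮v⟯[X] := C v' * q.map (algebraMap ℂ ℂ⟮v⟯) - p.map (algebraMap ℂ ℂ⟮v⟯)
  have hP0 : P ≠ 0 := by
    intro h0
    have := congr(eval (algebraMap ℂ ℂ⟮v⟯ r) $h0)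
    simp only [P, eval_sub, eval_mul, eval_C, eval_map_apply, hqr, map_zero, mul_zero, zero_sub,
      eval_zero, neg_eq_zero] at this
    exact hpr ((_root_.map_eq_zero (algebraMap ℂ ℂ⟮v⟯)).1 this)
  have hPdeg : P.natDegree ≤ 2 := by
    refine (natDegree_sub_le _ _).trans (max_le ?_ (natDegree_map_le.trans hp))
    exact (natDegree_C_mul_le _ _).trans (natDegree_map_le.trans hq)
  have hPX : aeval (RatFunc.X : RatFunc ℂ) P = 0 := by
    simp only [P, map_sub, map_mul, aeval_C, aeval_map_algebraMap,
      RatFunc.aeval_X_left_eq_algebraMap]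
    change v * _ - _ = 0
    rw [hv]
    field_simp
    simp
  have hint : IsAlgebraic ℂ⟮v⟯ (RatFunc.X : RatFunc ℂ) := ⟨P, hP0, hPX⟩
  have hmem : N ∈ ℂ⟮v⟯⟮(RatFunc.X : RatFunc ℂ)⟯ := by
    rw [RatFunc.IntermediateField.adjoin_X]
    exact IntermediateField.mem_top
  rw [← IntermediateField.mem_toSubalgebra,
    IntermediateField.adjoin_simple_toSubalgebra_of_isAlgebraic hint,
    Algebra.adjoin_singleton_eq_range_aeval] at hmem
  obtain ⟨f, hf⟩ := hmem
  change aeval (RatFunc.X : RatFunc ℂ) f = N at hf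
  -- Reduction modulo `P` writes `N` as `A t + B` with `A`, `B` in `ℂ(v)`. As `σ` fixes `ℂ(v)` and
  -- `N` but moves `t`, this forces `A = 0`.
  have hf' : aeval (RatFunc.X : RatFunc ℂ) (f % P) = N := by
    rw [← hf]
    conv_rhs => rw [← EuclideanDomain.div_add_mod f P]
    simp [hPX]
  have hdeg : (f % P).natDegree ≤ 1 := by
    rcases eq_or_ne (f % P) 0 with h0 | h0
    · simp [h0]
    have := natDegree_lt_natDegree h0 (EuclideanDomain.mod_lt f hP0)
    omega
  obtain ⟨A, B, hAB⟩ := exists_eq_X_add_C_of_natDegree_le_one hdeg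
  rw [hAB] at hf'
  simp only [map_add, map_mul, aeval_C, aeval_X] at hf'
  have hσ : ∀ x : ℂ⟮v⟯, σ (algebraMap ℂ⟮v⟯ (RatFunc ℂ) x) = algebraMap ℂ⟮v⟯ (RatFunc ℂ) x := by
    intro x
    obtain ⟨g, h, hgh⟩ := (IntermediateField.mem_adjoin_simple_iff ℂ _).1 x.2
    change σ x.1 = x.1
    rw [hgh, map_div₀, ← aeval_algHom_apply, ← aeval_algHom_apply, hσv]
  have hσN := hN
  rw [← hf', map_add, map_mul, hσ, hσ] at hσN
  have hA : algebraMap ℂ⟮v⟯ (RatFunc ℂ) A = 0 := by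
    have : algebraMap ℂ⟮v⟯ (RatFunc ℂ) A * (σ RatFunc.X - RatFunc.X) = 0 := by
      linear_combination hσN
    exact (mul_eq_zero.1 this).resolve_right (sub_ne_zero.2 hσX)
  rw [← hf', hA, zero_mul, zero_add]
  exact B.2

/-! ### Integrands that change sign under one involution. -/

section AntiInvariant

variable {M : GL (Fin 2) ℂ}

theorem natDegree_pairPoly_le (r : ℂ) : (pairPoly M r).natDegree ≤ 2 := by
  unfold pairPoly
  compute_degree

theorem pairPoly_eval_self (r : ℂ) : (pairPoly M r).eval r = 0 := by
  simp [pairPoly]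

theorem mobius_eq_of_trace_zero (hM : M 1 1 = -M 0 0) :
    mobius M = (RatFunc.C (M 0 0) * RatFunc.X + RatFunc.C (M 0 1)) /
      (RatFunc.C (M 1 0) * RatFunc.X - RatFunc.C (M 0 0)) := by
  rw [mobius, hM, map_neg, ← sub_eq_add_neg]

theorem denom_ne_zero_of_trace_zero (hM : M 1 1 = -M 0 0) :
    RatFunc.C (M 1 0) * RatFunc.X - RatFunc.C (M 0 0) ≠ 0 := by
  have := mobius_denom_ne_zero M
  rwa [hM, map_neg, ← sub_eq_add_neg] at this

theorem mobiusHom_X_ne (hM : M 1 1 = -M 0 0) : mobiusHom M RatFunc.X ≠ RatFunc.X := by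
  intro h
  rw [mobiusHom_X, mobius_eq_of_trace_zero hM, div_eq_iff (denom_ne_zero_of_trace_zero hM)] at h
  have hpoly : C (M 1 0) * X ^ 2 - C (2 * M 0 0) * X - C (M 0 1) = 0 := by
    apply RatFunc.algebraMap_injective ℂ
    simp only [map_sub, map_mul, map_pow, map_zero, RatFunc.algebraMap_C, RatFunc.algebraMap_X,
      map_ofNat]
    linear_combination -h
  have h0 : M 0 1 = 0 := by simpa using congr(coeff $hpoly 0)
  have h1 : M 0 0 = 0 := by simpa [coeff_X, coeff_C] using congr(coeff $hpoly 1)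
  exact det_entries_ne_zero M (by simp [h0, h1])

/-- `pairPoly M r` is a quadratic form that is multiplied by `-det M` under `M`. -/
theorem mobiusHom_pairPoly (hM : M 1 1 = -M 0 0) (r : ℂ) :
    mobiusHom M (algebraMap ℂ[X] (RatFunc ℂ) (pairPoly M r)) =
      RatFunc.C (M 0 0 ^ 2 + M 0 1 * M 1 0) * algebraMap ℂ[X] (RatFunc ℂ) (pairPoly M r) /
        (RatFunc.C (M 1 0) * RatFunc.X - RatFunc.C (M 0 0)) ^ 2 := by
  have hD := denom_ne_zero_of_trace_zero hM
  rw [pairPoly]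
  simp only [map_add, map_sub, map_mul, map_pow, RatFunc.algebraMap_C, RatFunc.algebraMap_X,
    mobiusHom_C, mobiusHom_X, mobius_eq_of_trace_zero hM]
  generalize hDe : RatFunc.C (M 1 0) * RatFunc.X - RatFunc.C (M 0 0) = D at hD
  field_simp
  rw [← hDe]
  ring

/-- Compared with `mobiusHom_pairPoly` there is an extra minus sign. It comes from differentiating
the invariant quotient of the two forms, since `S′ = -(a² + bc) / (c t - a)²`. This sign cancels
that of `F`. -/
theorem mobiusHom_wronskian (hM : M 1 1 = -M 0 0) (r s : ℂ) :
    mobiusHom M (algebraMap ℂ[X] (RatFunc ℂ) (wronskian (pairPoly M r) (pairPoly M s))) =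
      -(RatFunc.C (M 0 0 ^ 2 + M 0 1 * M 1 0) *
        algebraMap ℂ[X] (RatFunc ℂ) (wronskian (pairPoly M r) (pairPoly M s)) /
        (RatFunc.C (M 1 0) * RatFunc.X - RatFunc.C (M 0 0)) ^ 2) := by
  have hD := denom_ne_zero_of_trace_zero hM
  simp only [wronskian, pairPoly, derivative_mul, derivative_sub, derivative_X, derivative_C]
  simp only [map_add, map_sub, map_mul, map_pow, map_one, map_zero, RatFunc.algebraMap_C,
    RatFunc.algebraMap_X, mobiusHom_C, mobiusHom_X, mobius_eq_of_trace_zero hM]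
  generalize hDe : RatFunc.C (M 1 0) * RatFunc.X - RatFunc.C (M 0 0) = D at hD
  field_simp
  rw [← hDe]
  ring

theorem deriv_ratFunc_C (c : ℂ) : (RatFunc.C c)′ = 0 := by
  change ddt _ = 0
  have := ddt_div (C c) 1 one_ne_zero
  simpa using this

/-- If `F ∘ S = -F` for a pairing involution `S`, then `F / y` is of Liouville form. -/
theorem isLiouvilleForm_of_antiInvariant {R : ℂ[X]} (hdeg : R.natDegree = 3 ∨ R.natDegree = 4)
    (hsimple : R.Separable) (h : IsPairingInvolution R M) {F : RatFunc ℂ}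
    (hF : mobiusHom M F = -F) {K : Type} [Field K] [Differential K] [Algebra (RatFunc ℂ) K]
    [DifferentialAlgebra (RatFunc ℂ) K] {y : K}
    (hy : y ^ 2 = algebraMap (RatFunc ℂ) K (algebraMap ℂ[X] (RatFunc ℂ) R)) :
    IsLiouvilleForm (algebraMap (RatFunc ℂ) K F / y) := by
  have hM := apply_one_one_of_orderOf_eq_two h.1
  obtain ⟨κ, r, s, hR⟩ := h.exists_eq_mul hdeg hsimple
  have hR0 : R ≠ 0 := hsimple.ne_zero
  have hRr : R.eval r = 0 := by simp [hR, pairPoly_eval_self]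
  -- As `r` is a simple root and `q(r) = 0`, the value `κ q′(r) p(r)` is nonzero. Hence so are all
  -- three factors, and also `J(r) = -q′(r) p(r)`.
  have hR'r : (derivative R).eval r ≠ 0 := by
    have := hsimple.aeval_derivative_ne_zero (x := r) (by simpa using hRr)
    simpa using this
  set p := pairPoly M s with hp
  set q := pairPoly M r with hq
  have hqr : q.eval r = 0 := pairPoly_eval_self r
  rw [hR] at hR'r hR0
  simp only [derivative_mul, derivative_C, zero_mul, zero_add, eval_mul, eval_add, hqr, eval_C,
    add_zero, mul_ne_zero_iff] at hR'r
  have hq0 : q ≠ 0 := fun h0 => hR0 (by simp [h0])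
  set J := wronskian q p with hJ
  have hJ0 : J ≠ 0 := by
    intro h0
    have := congr(eval r $h0)
    simp [J, wronskian, hqr, hR'r.2.1, hR'r.2.2] at this
  obtain ⟨l, hl⟩ := IsAlgClosed.exists_pow_nat_eq κ (n := 2) (by norm_num)
  have hl0 : l ≠ 0 := by
    rintro rfl
    exact hR'r.1 (by simpa using hl.symm)
  have hq' := RatFunc.algebraMap_ne_zero hq0
  have hJ' := RatFunc.algebraMap_ne_zero hJ0
  have hlC : RatFunc.C l ≠ 0 := (_root_.map_ne_zero _).2 hl0
  have hΔ : RatFunc.C (M 0 0 ^ 2 + M 0 1 * M 1 0) ≠ 0 := by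
    refine (_root_.map_ne_zero _).2 fun h0 => det_entries_ne_zero M ?_
    rw [hM]
    linear_combination -h0
  have hD := denom_ne_zero_of_trace_zero hM
  set v : RatFunc ℂ := algebraMap ℂ[X] (RatFunc ℂ) p / algebraMap ℂ[X] (RatFunc ℂ) q with hv
  -- Chosen so that `F / y = N * w′` for `w = y / (l q)`: from `w ^ 2 = v` one gets `w′ = J / (2 w
  -- q²)`.
  set N : RatFunc ℂ := 2 * F * algebraMap ℂ[X] (RatFunc ℂ) q /
    (RatFunc.C l * algebraMap ℂ[X] (RatFunc ℂ) J) with hN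
  have hσv : mobiusHom M v = v := by
    rw [hv, map_div₀, hp, hq, mobiusHom_pairPoly hM, mobiusHom_pairPoly hM, ← hp, ← hq]
    field_simp
  have hσN : mobiusHom M N = N := by
    rw [hN, map_div₀, map_mul, map_mul, map_mul, map_ofNat, mobiusHom_C, hF, hJ,
      mobiusHom_wronskian hM, mobiusHom_pairPoly hM, ← hJ, ← hq]
    field_simp
  have hmem : N ∈ ℂ⟮v⟯ := mem_adjoin_of_fixed (natDegree_pairPoly_le s) (natDegree_pairPoly_le r)
    hqr hR'r.2.2 hq0 hv hσv (mobiusHom_X_ne hM) hσN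
  obtain ⟨f, g, hfg⟩ := (IntermediateField.mem_adjoin_simple_iff ℂ _).1 hmem
  let φ := algebraMap (RatFunc ℂ) K
  let : Algebra ℂ K := (φ.comp (algebraMap ℂ (RatFunc ℂ))).toAlgebra
  have : IsScalarTower ℂ (RatFunc ℂ) K := IsScalarTower.of_algebraMap_eq fun _ => rfl
  have : CharZero K := charZero_of_injective_algebraMap (algebraMap ℂ K).injective
  have hconst : ∀ c : ℂ, (algebraMap ℂ K c)′ = 0 := by
    intro c
    change (algebraMap (RatFunc ℂ) K (RatFunc.C c))′ = 0
    rw [deriv_algebraMap, deriv_ratFunc_C, map_zero]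
  have hy0 : y ≠ 0 := by
    rintro rfl
    rw [hR] at hy
    exact (_root_.map_ne_zero φ).2 (RatFunc.algebraMap_ne_zero hR0) (by simpa [φ] using hy.symm)
  have hφq : φ (algebraMap ℂ[X] (RatFunc ℂ) q) ≠ 0 := (_root_.map_ne_zero φ).2 hq'
  have hφJ : φ (algebraMap ℂ[X] (RatFunc ℂ) J) ≠ 0 := (_root_.map_ne_zero φ).2 hJ'
  have hφl : φ (RatFunc.C l) ≠ 0 := (_root_.map_ne_zero φ).2 hlC
  set w : K := y / (φ (RatFunc.C l) * φ (algebraMap ℂ[X] (RatFunc ℂ) q)) with hw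
  have hw2 : w ^ 2 = φ v := by
    rw [hw, div_pow, hy, hR, ← hl, hv]
    change φ _ / _ = _
    simp only [map_mul, map_pow, map_div₀, RatFunc.algebraMap_C]
    field_simp
  have hw' : 2 * w * w′ = φ (algebraMap ℂ[X] (RatFunc ℂ) J) /
      φ (algebraMap ℂ[X] (RatFunc ℂ) q) ^ 2 := by
    have h1 : (w ^ 2)′ = 2 * w * w′ := by
      simp [Derivation.leibniz_pow, mul_assoc]
    have h2 : v′ = algebraMap ℂ[X] (RatFunc ℂ) J / algebraMap ℂ[X] (RatFunc ℂ) q ^ 2 := by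
      change ddt v = _
      rw [hv, ddt_div p q hq0, hJ, wronskian, map_sub, map_mul, map_mul]
      ring
    rw [← h1, hw2, deriv_algebraMap, h2, map_div₀, map_pow]
  have key : φ F / y = φ N * w′ := by
    have h3 : w′ = φ (algebraMap ℂ[X] (RatFunc ℂ) J) /
        φ (algebraMap ℂ[X] (RatFunc ℂ) q) ^ 2 / (2 * w) := by
      have hw0 : w ≠ 0 := div_ne_zero hy0 (mul_ne_zero hφl hφq)
      rw [← hw']
      field_simp
    rw [h3, hN, hw]
    simp only [map_mul, map_div₀, map_ofNat]
    field_simp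
  -- A rational function of `v` is one of `w` after replacing the variable by its square.
  have hφN : φ N = aeval w (expand ℂ 2 f) / aeval w (expand ℂ 2 g) := by
    rw [expand_aeval, expand_aeval, hw2, hfg, map_div₀]
    simp only [φ, aeval_algebraMap_apply]
  change IsLiouvilleForm (φ F / y)
  rw [key, hφN]
  exact IsLiouvilleForm.aeval_div_aeval_mul_deriv hconst w _ _

end AntiInvariant

end

end Goursat

/-! ### Splitting the integrand by two of the involutions. -/

theorem theorem3p5 (R : Polynomial ℂ) (hdeg : R.natDegree = 3 ∨ R.natDegree = 4)
    (hsimple : R.Separable)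
    (M₁ M₂ M₃ : GL (Fin 2) ℂ)
    (h₁ : Goursat.IsPairingInvolution R M₁)
    (h₂ : Goursat.IsPairingInvolution R M₂)
    (h₃ : Goursat.IsPairingInvolution R M₃)
    (h₁₂ : Matrix.ProjGenLinGroup.mk M₁ ≠ Matrix.ProjGenLinGroup.mk M₂)
    (h₁₃ : Matrix.ProjGenLinGroup.mk M₁ ≠ Matrix.ProjGenLinGroup.mk M₃)
    (h₂₃ : Matrix.ProjGenLinGroup.mk M₂ ≠ Matrix.ProjGenLinGroup.mk M₃)
    (F : RatFunc ℂ)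
    (hF : F + Goursat.compMobius F M₁ + Goursat.compMobius F M₂ + Goursat.compMobius F M₃ = 0) :
    Goursat.IsPseudoElliptic R F := by
  intro K _ _ _ _ y hy _
  apply Goursat.IsLiouvilleForm.hasElementaryIntegral
  simp only [Goursat.compMobius_eq] at hF
  have hmul := Goursat.mk_mul_eq_of_isPairingInvolution hdeg hsimple h₁ h₂ h₃ h₁₂ h₁₃ h₂₃
  have h₃' : Goursat.mobiusHom M₂ (Goursat.mobiusHom M₁ F) = Goursat.mobiusHom M₃ F := by
    rw [Goursat.mobiusHom_mobiusHom, Goursat.mobiusHom_eq_of_mk_eq hmul]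
  have hsq : Goursat.mobiusHom M₁ (Goursat.mobiusHom M₁ F) = F := by
    have hM : Matrix.ProjGenLinGroup.mk (M₁ * M₁) = Matrix.ProjGenLinGroup.mk 1 := by
      rw [map_mul, ← pow_two, orderOf_dvd_iff_pow_eq_one.1 h₁.1.dvd, map_one]
    rw [Goursat.mobiusHom_mobiusHom, Goursat.mobiusHom_eq_of_mk_eq hM]
    have : Goursat.mobiusHom 1 = AlgHom.id ℂ (RatFunc ℂ) := by
      apply Goursat.algHom_ext_of_X
      simp [Goursat.mobiusHom_X, Goursat.mobius]
    rw [this, AlgHom.id_apply]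
  have e₁ : Goursat.mobiusHom M₁ ((F - Goursat.mobiusHom M₁ F) / 2) =
      -((F - Goursat.mobiusHom M₁ F) / 2) := by
    rw [map_div₀, map_sub, hsq, map_ofNat]
    ring
  -- Composition with `S₂` turns `F + F ∘ S₁` into `F ∘ S₂ + F ∘ S₃`, which the hypothesis equates
  -- with its negative.
  have e₂ : Goursat.mobiusHom M₂ ((F + Goursat.mobiusHom M₁ F) / 2) =
      -((F + Goursat.mobiusHom M₁ F) / 2) := by
    rw [map_div₀, map_add, h₃', map_ofNat]
    linear_combination hF / 2
  have hsum : algebraMap (RatFunc ℂ) K F / y =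
      algebraMap (RatFunc ℂ) K ((F - Goursat.mobiusHom M₁ F) / 2) / y +
        algebraMap (RatFunc ℂ) K ((F + Goursat.mobiusHom M₁ F) / 2) / y := by
    rw [← add_div, ← map_add]
    congr 2
    ring
  rw [hsum]
  exact (Goursat.isLiouvilleForm_of_antiInvariant hdeg hsimple h₁ e₁ hy).add
    (Goursat.isLiouvilleForm_of_antiInvariant hdeg hsimple h₂ e₂ hy)
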